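/- Conventions. For a finite connected simple graph $G$, write $|G|$ for its number of vertices, $d_{uv}$ for the graph distance, and $\mathcal W_G=\frac12\sum_{u,v}d_{uv}$ for its Wiener index (sum over ordered pairs of vertices). For the simple random walk on $G$ (at each step the walker moves to a uniformly chosen neighbour), let $\mathcal H_{u\to v}$ be the expected time at which the walk started at $u$ first reaches $v$ (so $\mathcal H_{u\to u}=0$). The mean hitting time is $\langle\mathcal H_G\rangle=\frac{1}{|G|(|G|-1)}\sum_{u,v}\mathcal H_{u\to v}$ (read as $0$ if $|G|=1$). If every vertex degree $k_u$ of $G$ is at most $m$, the $m$-order V-fractal operation on $G$ places two new vertices on each edge (each edge becomes a path of length $3$) and attaches $m-k_u$ new leaves to each vertex $u$ of $G$, where $k_u$ is the degree of $u$ in $G$. Proposition I.14. Let $T$ be an arbitrary finite tree with $n$ vertices, let $m,t\ge 0$ be integers, and let $T^V_m(0)=T$, with $T^V_m(s+1)$ the result of applying the $m$-order V-fractal operation to $T^V_m(s)$. Assume that the operation is applicable in each of the $t$ steps, that is, that $T^V_m(s)$ has maximum degree at most $m$ for every $0\le s<t$ (for $m\ge 2$ it suffices that $T$ has maximum degree at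 most $m$). Then $|T^V_m(t)|=n(m+1)^t$, all hitting times on $T^V_m(t)$ are finite, and $$\langle\mathcal H_{T^V_m(t)}\rangle=\frac{2}{|T^V_m(t)|}\left\{f_5^{\,t}\,\mathcal W_T+g_5\sum_{i=0}^{t-1}f_5^{\,i}\,|T^V_m(t-1-i)|^2+h_5\sum_{i=0}^{t-1}f_5^{\,i}\,|T^V_m(t-1-i)|\right\},$$ where $f_5=3(m+1)^2$, $g_5=(m-2)(m+1)$ and $h_5=m+2$. -/

import Mathlib

open MeasureTheory ProbabilityTheory
open scoped ENNReal

universe u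

/-- A finite simple graph, bundled with its vertex type (the vertex type grows when an operation
is applied to the graph). -/
structure FinGraph : Type (u + 1) where
  /-- the vertex type -/
  V : Type u
  /-- there are finitely many vertices -/
  [fintypeV : Fintype V]
  /-- the graph -/
  graph : SimpleGraph V

namespace FinGraph

instance instFintypeV (G : FinGraph.{u}) : Fintype G.V := G.fintypeV

instance instMeasurableSpaceV (G : FinGraph.{u}) : MeasurableSpace G.V := ⊤

instance instDiscreteMeasurableSpaceV (G : FinGraph.{u}) : DiscreteMeasurableSpace G.V where
  forall_measurableSet _ := MeasurableSpace.measurableSet_top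

/-- The number of vertices. -/
def order (G : FinGraph.{u}) : ℕ := Fintype.card G.V

open Classical in
/-- The degree of a vertex. -/
noncomputable def deg (G : FinGraph.{u}) (u : G.V) : ℕ := G.graph.degree u

/-! ### Wiener index -/

/-- The Wiener index: half of the sum of the distances over all ordered pairs of vertices. -/
noncomputable def wiener (G : FinGraph.{u}) : ℝ :=
  (1 / 2) * ∑ u : G.V, ∑ v : G.V, (G.graph.dist u v : ℝ)

/-! ### Random walk and hitting times -/

open Classical in
/-- One step of the unbiased random walk from `u`: a uniformly chosen neighbour of `u`. (A vertex
without neighbours occurs in a connected graph only if it is the only vertex; the walk stays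
there.) -/
noncomputable def stepLaw (G : FinGraph.{u}) (u : G.V) : PMF G.V :=
  if h : (G.graph.neighborFinset u).Nonempty then
    PMF.uniformOfFinset (G.graph.neighborFinset u) h
  else PMF.pure u

/-- The transition kernel of the random walk. -/
noncomputable def stepKernel (G : FinGraph.{u}) : Kernel G.V G.V where
  toFun u := (G.stepLaw u).toMeasure
  measurable' := measurable_from_top

instance instIsMarkovKernelStepKernel (G : FinGraph.{u}) : IsMarkovKernel G.stepKernel :=
  ⟨fun u => inferInstanceAs (IsProbabilityMeasure (G.stepLaw u).toMeasure)⟩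

/-- The kernel that chooses the position at time `k + 1` from the positions at the times
`0, …, k`: it uses the position at time `k` only. -/
noncomputable def pathKernel (G : FinGraph.{u}) (k : ℕ) :
    Kernel ((i : Finset.Iic k) → (fun _ : ℕ => G.V) i) G.V :=
  G.stepKernel.comap (fun x => x ⟨k, Finset.mem_Iic.2 le_rfl⟩) (measurable_pi_apply _)

instance instIsMarkovKernelPathKernel (G : FinGraph.{u}) (k : ℕ) :
    IsMarkovKernel (G.pathKernel k) :=
  inferInstanceAs (IsMarkovKernel (G.stepKernel.comap _ _))

/-- The law, on the space of trajectories `ℕ → G.V`, of the random walk that starts at `u`. -/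
noncomputable def walkLaw (G : FinGraph.{u}) (u : G.V) : Measure (ℕ → G.V) :=
  Kernel.traj (X := fun _ : ℕ => G.V) G.pathKernel 0 (fun _ => u)

/-- The first time at which the trajectory `ω` is at `v` (`∞` if it never is). -/
noncomputable def firstTime (G : FinGraph.{u}) (v : G.V) (ω : ℕ → G.V) : ℝ≥0∞ :=
  ⨅ (k : ℕ) (_ : ω k = v), (k : ℝ≥0∞)

/-- The hitting time from `u` to `v`: the expected time at which the random walk that starts at `u`
first reaches `v`. -/
noncomputable def hittingTime (G : FinGraph.{u}) (u v : G.V) : ℝ≥0∞ :=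
  ∫⁻ ω, G.firstTime v ω ∂(G.walkLaw u)

/-- The mean hitting time: the average of the hitting times over the ordered pairs of distinct
vertices (the hitting time from a vertex to itself is `0`). -/
noncomputable def meanHittingTime (G : FinGraph.{u}) : ℝ :=
  (∑ u : G.V, ∑ v : G.V, (G.hittingTime u v).toReal) / ((G.order : ℝ) * ((G.order : ℝ) - 1))

/-! ### The V-fractal operation -/

/-- The vertices after the V-fractal operation of order `m`: the old vertices, two new vertices for
each edge (one for each orientation `(u, v)` of the edge, which is the one placed next to `u`), and
`m - deg u` new vertices for each old vertex `u`. -/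
inductive VVertex (G : FinGraph.{u}) (m : ℕ) : Type u
  | old (u : G.V) : VVertex G m
  | mid (d : G.graph.Dart) : VVertex G m
  | leaf (u : G.V) (i : Fin (m - G.deg u)) : VVertex G m

/-- The vertices after the operation, as a sum type. -/
def vVertexEquiv (G : FinGraph.{u}) (m : ℕ) :
    VVertex G m ≃ G.V ⊕ G.graph.Dart ⊕ (Σ u : G.V, Fin (m - G.deg u)) where
  toFun
    | .old u => Sum.inl u
    | .mid d => Sum.inr (Sum.inl d)
    | .leaf u i => Sum.inr (Sum.inr ⟨u, i⟩)
  invFun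
    | Sum.inl u => .old u
    | Sum.inr (Sum.inl d) => .mid d
    | Sum.inr (Sum.inr ⟨u, i⟩) => .leaf u i
  left_inv x := by cases x <;> rfl
  right_inv x := by rcases x with _ | _ | ⟨_, _⟩ <;> rfl

open Classical in
noncomputable instance instFintypeVVertex (G : FinGraph.{u}) (m : ℕ) : Fintype (VVertex G m) :=
  Fintype.ofEquiv _ (G.vVertexEquiv m).symm

/-- Adjacency after the V-fractal operation: each edge `{u, v}` is replaced by the path
`u, mid (u, v), mid (v, u), v`, and the new vertices `leaf u i` are joined to `u`. -/
def VAdj (G : FinGraph.{u}) (m : ℕ) : VVertex G m → VVertex G m → Prop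
  | .old u, .mid d => d.fst = u
  | .mid d, .old u => d.fst = u
  | .mid d, .mid e => e = d.symm
  | .old u, .leaf v _ => u = v
  | .leaf v _, .old u => u = v
  | _, _ => False

/-- The graph that results from the V-fractal operation of order `m`. -/
def vGraph (G : FinGraph.{u}) (m : ℕ) : SimpleGraph (VVertex G m) where
  Adj := G.VAdj m
  symm := ⟨by
    rintro (u | d | ⟨u, i⟩) (v | e | ⟨v, j⟩) h <;> simp_all [VAdj]⟩
  loopless := ⟨by
    rintro (u | d | ⟨u, i⟩) h
    · exact h
    · exact d.symm_ne h.symm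
    · exact h⟩

/-- The V-fractal operation of order `m`, as a map on finite graphs. -/
noncomputable def vOp (m : ℕ) (G : FinGraph.{u}) : FinGraph.{u} where
  V := VVertex G m
  graph := G.vGraph m

/-- The V-fractal operation of order `m` may be applied to `G`: no vertex has a degree greater than
`m`. -/
def VApplicable (m : ℕ) (G : FinGraph.{u}) : Prop := ∀ u : G.V, G.deg u ≤ m

/-- The generalized V-fractal after `t` time steps with seed `G`. -/
noncomputable def vFractal (m : ℕ) (G : FinGraph.{u}) : ℕ → FinGraph.{u}
  | 0 => G
  | t + 1 => vOp m (vFractal m G t)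

end FinGraph

namespace FinGraph

/-! ### Hitting times as solutions of a linear system -/

/-! On a tree the graph Laplacian of the distance to `v` is explicit: away from `v` one neighbour is
closer and all others are farther (`sum_neighborFinset`). Hence `treeHit`, that is ½ ∑_w k_w (d_uv +
d_vw − d_uw), solves the first-step equations, and as a finite solution it is the hitting time
(`hittingTime_eq_of_solution`). Summed over `u` and `v`, the terms d_vw and d_uw cancel and ∑ k_w =
2(n − 1) remains, so the mean hitting time is 2W/n (`meanHittingTime_of_isTreeDist`).

It remains to follow the Wiener index. Every new vertex belongs to the cluster of an old one, its
root. For distinct x, y the new distance is three times the distance of the roots, plus an offset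
for each endpoint: 0 for an old vertex, 1 for a leaf, and for a vertex inside an edge −1 or +1
according to whether the other root lies beyond that edge or not. Clusters have m + 1 vertices and
the offsets sum to a value independent of the target, so W' = f₅ W + g₅ n² + h₅ n (`wiener_vOp`),
which is then unrolled.

The axioms `IsTreeDist` determine the graph distance and are checked directly for the new distance
(`vDist_isTreeDist`), so no fractal has to be shown to be a tree in the sense of unique paths. -/

theorem lintegral_stepKernel (G : FinGraph.{u}) (x : G.V) (φ : G.V → ℝ≥0∞) :
    ∫⁻ y, φ y ∂(G.stepKernel x) = ∑ y, G.stepLaw x y * φ y := by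
  rw [lintegral_fintype]
  refine Finset.sum_congr rfl fun y _ => ?_
  rw [mul_comm]
  congr 1
  exact PMF.toMeasure_apply_singleton _ _ (measurableSet_singleton _)

/-- The Markov property: given the history up to time `n`, which `f` may use in full, the next
position is distributed by the step law at `ω n`. -/
theorem lintegral_walkLaw_succ (G : FinGraph.{u}) (u : G.V) (n : ℕ)
    (f : (Finset.Iic n → G.V) → ℝ≥0∞) (φ : G.V → ℝ≥0∞) :
    ∫⁻ ω, f (fun i => ω i) * φ (ω (n + 1)) ∂(G.walkLaw u) =
      ∫⁻ ω, f (fun i => ω i) * ∑ y, G.stepLaw (ω n) y * φ y ∂(G.walkLaw u) := by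
  have hf : Measurable fun ω : ℕ → G.V => f (fun i => ω i) :=
    (Measurable.of_discrete (f := f)).comp
      (measurable_pi_lambda _ fun i => measurable_pi_apply _)
  have hφ : ∀ (ψ : G.V → ℝ≥0∞) (k : ℕ), Measurable fun ω : ℕ → G.V => ψ (ω k) := fun ψ k =>
    (Measurable.of_discrete (f := ψ)).comp (measurable_pi_apply _)
  -- Conditioning on the history `z` up to time `n`. The index `k` is free because both `k = n + 1`
  -- and `k = n` are needed.
  have hz : ∀ (ψ : G.V → ℝ≥0∞) (k : ℕ),
      ∫⁻ ω, f (fun i => ω i) * ψ (ω k) ∂(G.walkLaw u) =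
      ∫⁻ z, f z * ∫⁻ ω, ψ (Function.updateFinset ω (Finset.Iic n) z k)
          ∂(Kernel.traj (X := fun _ : ℕ => G.V) G.pathKernel n z)
        ∂(Kernel.partialTraj (X := fun _ : ℕ => G.V) G.pathKernel 0 n (fun _ => u)) := by
    intro ψ k
    rw [walkLaw, ← Kernel.traj_comp_partialTraj (Nat.zero_le n),
      Kernel.lintegral_comp (g := fun ω : ℕ → G.V => f (fun i => ω i) * ψ (ω k)) _ _ _
        (hf.mul (hφ ψ k))]
    refine lintegral_congr fun z => ?_
    rw [Kernel.lintegral_traj (f := fun ω : ℕ → G.V => f (fun i => ω i) * ψ (ω k)) z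
      (hf.mul (hφ ψ k)), ← lintegral_const_mul]
    · refine lintegral_congr fun ω => ?_
      congr 2
      funext i
      simp [Function.updateFinset]
    · exact (hφ ψ k).comp measurable_updateFinset_left
  rw [hz, hz (fun x => ∑ y, G.stepLaw x y * φ y)]
  refine lintegral_congr fun z => ?_
  congr 1
  have h1 : ∀ ω : ℕ → G.V, Function.updateFinset ω (Finset.Iic n) z (n + 1) = ω (n + 1) := by
    intro ω; simp [Function.updateFinset]
  have h2 : ∀ ω : ℕ → G.V, Function.updateFinset ω (Finset.Iic n) z n =
      z ⟨n, Finset.mem_Iic.2 le_rfl⟩ := by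
    intro ω; simp [Function.updateFinset]
  simp only [h1, h2, lintegral_const, measure_univ, mul_one]
  rw [← lintegral_stepKernel]
  change _ = ∫⁻ y, φ y ∂(G.pathKernel n z)
  rw [← Kernel.map_traj_succ_self (κ := G.pathKernel) (X := fun _ : ℕ => G.V),
    Kernel.map_apply _ (measurable_pi_apply _),
    lintegral_map Measurable.of_discrete (measurable_pi_apply _)]

theorem lintegral_walkLaw_zero (G : FinGraph.{u}) (u : G.V) (φ : G.V → ℝ≥0∞) :
    ∫⁻ ω, φ (ω 0) ∂(G.walkLaw u) = φ u := by
  rw [walkLaw, Kernel.lintegral_traj (f := fun ω : ℕ → G.V => φ (ω 0)) _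
    ((Measurable.of_discrete (f := φ)).comp (measurable_pi_apply _))]
  simp only [Function.updateFinset, Finset.mem_Iic, le_refl, dite_true]
  have : IsProbabilityMeasure
    (Kernel.traj (X := fun _ : ℕ => G.V) G.pathKernel 0 (fun _ => u)) := inferInstance
  simp

open Classical in
/-- One step of the random walk killed at `v`, acting on functions. -/
noncomputable def killedStep (G : FinGraph.{u}) (v : G.V) (φ : G.V → ℝ≥0∞) (x : G.V) : ℝ≥0∞ :=
  if x = v then 0 else ∑ y, G.stepLaw x y * φ y

open Classical in
/-- The indicator of the complement of `v`. -/
noncomputable def offPoint (G : FinGraph.{u}) (v x : G.V) : ℝ≥0∞ := if x = v then 0 else 1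

open Classical in
-- The product is the indicator that `v` is avoided up to time `n`; each Markov step turns one
-- factor of it into one application of `killedStep`.
theorem lintegral_survival (G : FinGraph.{u}) (u v : G.V) (n : ℕ) (φ : G.V → ℝ≥0∞)
    (hφ : φ v = 0) :
    ∫⁻ ω, (∏ i : Finset.Iic n, G.offPoint v (ω i)) * φ (ω n) ∂(G.walkLaw u) =
      (G.killedStep v)^[n] φ u := by
  induction n generalizing φ with
  | zero =>
    rw [Function.iterate_zero_apply, ← lintegral_walkLaw_zero G u φ]
    refine lintegral_congr fun ω => ?_
    rw [Finset.prod_coe_sort (Finset.Iic 0) fun i => G.offPoint v (ω i),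
      ← Nat.range_succ_eq_Iic, Finset.prod_range_one]
    by_cases h : ω 0 = v <;> simp [offPoint, h, hφ]
  | succ n ih =>
    rw [Function.iterate_succ_apply, ← ih _ (by simp [killedStep])]
    have h1 : ∀ ω : ℕ → G.V, (∏ i : Finset.Iic (n + 1), G.offPoint v (ω i)) * φ (ω (n + 1)) =
        (∏ i : Finset.Iic n, G.offPoint v (ω i)) * φ (ω (n + 1)) := by
      intro ω
      rw [Finset.prod_coe_sort (Finset.Iic (n + 1)) fun i => G.offPoint v (ω i),
        Finset.prod_coe_sort (Finset.Iic n) fun i => G.offPoint v (ω i),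
        ← Nat.range_succ_eq_Iic, ← Nat.range_succ_eq_Iic, Finset.prod_range_succ]
      by_cases h : ω (n + 1) = v <;> simp [offPoint, h, hφ]
    have h2 : ∀ ω : ℕ → G.V, (∏ i : Finset.Iic n, G.offPoint v (ω i)) * G.killedStep v φ (ω n) =
        (∏ i : Finset.Iic n, G.offPoint v (ω i)) * ∑ y, G.stepLaw (ω n) y * φ y := by
      intro ω
      rw [Finset.prod_coe_sort (Finset.Iic n) fun i => G.offPoint v (ω i),
        ← Nat.range_succ_eq_Iic, Finset.prod_range_succ]
      by_cases h : ω n = v <;> simp [offPoint, killedStep, h]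
    simp only [h1, h2]
    exact lintegral_walkLaw_succ G u n (fun z => ∏ i, G.offPoint v (z i)) φ

/-- Tail sum: the first visit happens at the time that equals the number of `n` with no visit up to
`n`. Both sides are `∞` if `v` is never visited. -/
theorem firstTime_eq_tsum (G : FinGraph.{u}) (v : G.V) (ω : ℕ → G.V) :
    G.firstTime v ω = ∑' n : ℕ, ∏ i : Finset.Iic n, G.offPoint v (ω i) := by
  classical
  have hp : ∀ n, ∏ i : Finset.Iic n, G.offPoint v (ω i) = if ∃ i ≤ n, ω i = v then 0 else 1 := by
    intro n
    rw [Finset.prod_coe_sort (Finset.Iic n) fun i => G.offPoint v (ω i)]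
    split_ifs with h
    · obtain ⟨i, hi, h⟩ := h
      exact Finset.prod_eq_zero (Finset.mem_Iic.2 hi) (by simp [offPoint, h])
    · push Not at h
      exact Finset.prod_eq_one fun i hi => by simp [offPoint, h i (Finset.mem_Iic.1 hi)]
  simp only [hp, firstTime]
  by_cases h : ∃ k, ω k = v
  · have h0 := Nat.find_spec h
    rw [tsum_eq_sum (s := Finset.range (Nat.find h))]
    · rw [Finset.sum_congr rfl (g := fun _ => (1 : ℝ≥0∞))]
      · simp only [Finset.sum_const, Finset.card_range, nsmul_eq_mul, mul_one]
        refine le_antisymm (iInf₂_le (Nat.find h) h0) (le_iInf₂ fun k hk => ?_)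
        exact_mod_cast Nat.find_min' h hk
      · intro n hn
        refine if_neg ?_
        rintro ⟨i, hi, hiv⟩
        exact Nat.find_min h (lt_of_le_of_lt hi (Finset.mem_range.1 hn)) hiv
    · intro n hn
      exact if_pos ⟨_, not_lt.1 fun h' => hn (Finset.mem_range.2 h'), h0⟩
  · push Not at h
    simp [h]

theorem hittingTime_eq_tsum (G : FinGraph.{u}) (u v : G.V) :
    G.hittingTime u v = ∑' n : ℕ, (G.killedStep v)^[n] (G.offPoint v) u := by
  have hm : ∀ n : ℕ, Measurable fun ω : ℕ → G.V => ∏ i : Finset.Iic n, G.offPoint v (ω i) := by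
    intro n
    refine Finset.measurable_prod _ fun i _ => ?_
    exact (Measurable.of_discrete (f := G.offPoint v)).comp (measurable_pi_apply i.1)
  simp only [hittingTime, firstTime_eq_tsum]
  rw [lintegral_tsum fun n => (hm n).aemeasurable]
  refine tsum_congr fun n => ?_
  rw [← lintegral_survival _ _ _ _ _ (by simp [offPoint])]
  refine lintegral_congr fun ω => ?_
  rw [Finset.prod_coe_sort (Finset.Iic n) fun i => G.offPoint v (ω i),
    ← Nat.range_succ_eq_Iic, Finset.prod_range_succ]
  by_cases h : ω n = v <;> simp [offPoint, h]

theorem killedStep_add (G : FinGraph.{u}) (v : G.V) (φ ψ : G.V → ℝ≥0∞) :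
    G.killedStep v (φ + ψ) = G.killedStep v φ + G.killedStep v ψ := by
  funext x
  by_cases h : x = v <;> simp [killedStep, h, mul_add, Finset.sum_add_distrib]

theorem killedStep_smul (G : FinGraph.{u}) (v : G.V) (c : ℝ≥0∞) (φ : G.V → ℝ≥0∞) :
    G.killedStep v (c • φ) = c • G.killedStep v φ := by
  funext x
  by_cases h : x = v <;> simp [killedStep, h, mul_left_comm, Finset.mul_sum]

theorem killedStep_mono (G : FinGraph.{u}) (v : G.V) : Monotone (G.killedStep v) := by
  intro φ ψ h x
  unfold killedStep
  split_ifs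
  · exact le_rfl
  · gcongr with y
    exact h y

/-- The hitting times of `v` are the only finite solution of the first-step equations. -/
theorem hittingTime_eq_of_solution (G : FinGraph.{u}) (v : G.V) (F : G.V → ℝ≥0∞)
    (hfin : ∀ x, F x ≠ ∞) (hv : F v = 0)
    (hF : ∀ x, x ≠ v → F x = 1 + ∑ y, G.stepLaw x y * F y) (u : G.V) :
    G.hittingTime u v = F u := by
  set Q := G.killedStep v
  set e := G.offPoint v
  have hQ : F = e + Q F := by
    funext x
    by_cases h : x = v
    · simp [e, Q, offPoint, killedStep, h, hv]
    · simp [e, Q, offPoint, killedStep, h, ← hF x h]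
  have hadd : ∀ n φ ψ, Q^[n] (φ + ψ) = Q^[n] φ + Q^[n] ψ := by
    intro n
    induction n with
    | zero => simp
    | succ n ih => intro φ ψ; simp only [Function.iterate_succ_apply, Q, killedStep_add, ih]
  have hsmul : ∀ n (c : ℝ≥0∞) φ, Q^[n] (c • φ) = c • Q^[n] φ := by
    intro n
    induction n with
    | zero => simp
    | succ n ih => intro φ ψ; simp only [Function.iterate_succ_apply, Q, killedStep_smul, ih]
  -- Iterating `F = e + Q F` gives the partial sums of the series for the hitting time, with
  -- remainder `Q^[n] F u`.
  have hsum : ∀ n, F u = ∑ k ∈ Finset.range n, Q^[k] e u + Q^[n] F u := by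
    intro n
    induction n with
    | zero => simp
    | succ n ih =>
      rw [ih, Finset.sum_range_succ, add_assoc, Function.iterate_succ_apply]
      conv_lhs => rw [hQ, hadd]
      rfl
  have hle : ∑' n, Q^[n] e u ≤ F u := by
    rw [ENNReal.tsum_eq_iSup_nat]
    exact iSup_le fun n => (hsum n).symm ▸ le_self_add
  have hne : ∑' n, Q^[n] e u ≠ ∞ := ne_top_of_le_ne_top (hfin u) hle
  set C := ∑ x, F x
  have hC : C ≠ ∞ := ENNReal.sum_ne_top.2 fun x _ => hfin x
  -- The remainder is thereby at most `C` times the `n`-th term of a series bounded by `F u`, so it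
  -- tends to 0; no separate recurrence argument is needed.
  have hFC : F ≤ C • e := by
    intro x
    by_cases h : x = v
    · simp [h, hv]
    · simpa [e, offPoint, h] using
        Finset.single_le_sum (f := F) (fun _ _ => zero_le) (Finset.mem_univ x)
  have h0 : Filter.Tendsto (fun n => Q^[n] F u) Filter.atTop (nhds 0) := by
    have h1 := ENNReal.Tendsto.const_mul (ENNReal.tendsto_atTop_zero_of_tsum_ne_top hne)
      (Or.inr hC)
    rw [mul_zero] at h1
    refine tendsto_of_tendsto_of_tendsto_of_le_of_le tendsto_const_nhds h1 (fun _ => zero_le)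
      fun n => ?_
    have := (G.killedStep_mono v).iterate n hFC u
    simpa [Q, ← hsmul] using this.trans_eq (congrFun (hsmul n C e) u)
  rw [hittingTime_eq_tsum]
  have h2 := (ENNReal.tendsto_nat_tsum fun n => Q^[n] e u).add h0
  simp only [← hsum, add_zero] at h2
  exact tendsto_nhds_unique h2 tendsto_const_nhds

end FinGraph

/-! ### Tree distances -/

/-- An integer-valued function that behaves like the distance of a tree: from every vertex
`u ≠ v`, exactly one neighbour is closer to `v`, and the others are farther away. -/
structure SimpleGraph.IsTreeDist {V : Type*} (G : SimpleGraph V) (D : V → V → ℤ) : Prop where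
  nonneg : ∀ u v, 0 ≤ D u v
  self : ∀ v, D v v = 0
  symm : ∀ u v, D u v = D v u
  adj : ∀ u v, G.Adj u v → D u v = 1
  step : ∀ u v, u ≠ v → ∃ x, G.Adj u x ∧ D x v = D u v - 1 ∧
    ∀ y, G.Adj u y → y ≠ x → D y v = D u v + 1

theorem SimpleGraph.IsTree.isTreeDist {V : Type*} {G : SimpleGraph V} (hG : G.IsTree) :
    G.IsTreeDist fun u v => (G.dist u v : ℤ) where
  nonneg u v := by positivity
  self v := by simp
  symm u v := by rw [G.dist_comm]
  adj u v h := by simp [SimpleGraph.dist_eq_one_iff_adj.2 h]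
  step u v huv := by
    obtain ⟨p, hp, hpl⟩ := hG.connected.exists_path_of_dist u v
    have hnil : ¬p.Nil := fun h => huv h.eq
    have hadj := p.adj_snd hnil
    have key : ∀ y, G.Adj u y → G.dist u v = G.dist y v + 1 ∨ G.dist y v = G.dist u v + 1 := by
      intro y hy
      have := hG.dist_eq_dist_add_one_of_adj v hy
      rwa [G.dist_comm, G.dist_comm (v := y)] at this
    refine ⟨p.snd, hadj, ?_, fun y hy hne => ?_⟩
    · have h1 : p.tail.length + 1 = p.length := p.length_tail_add_one hnil
      have h2 := SimpleGraph.dist_le p.tail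
      rcases key _ hadj with h | h <;> omega
    · rcases key y hy with h | h
      -- A second closer neighbour would start a second shortest path from `u` to `v`.
      · exfalso
        apply hne
        obtain ⟨q, hq, hql⟩ := hG.connected.exists_path_of_dist y v
        have hcl : (SimpleGraph.Walk.cons hy q).IsPath :=
          (SimpleGraph.Walk.cons hy q).isPath_of_length_eq_dist (by simp [hql, h])
        have heq := (hG.isAcyclic.subsingleton_path u v).elim ⟨_, hcl⟩ ⟨p, hp⟩
        have heq : SimpleGraph.Walk.cons hy q = p := congrArg Subtype.val heq
        rw [← heq, SimpleGraph.Walk.snd_cons]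
      · exact_mod_cast h

namespace SimpleGraph.IsTreeDist

variable {V : Type*} {G : SimpleGraph V} {D : V → V → ℤ}

theorem eq_of_eq_zero (h : G.IsTreeDist D) {u v : V} (huv : D u v = 0) : u = v := by
  by_contra hne
  obtain ⟨x, -, hx, -⟩ := h.step u v hne
  have := h.nonneg x v
  omega

theorem adj_cases (h : G.IsTreeDist D) {u x : V} (hux : G.Adj u x) (v : V) :
    D x v = D u v + 1 ∨ D x v = D u v - 1 := by
  by_cases huv : u = v
  · subst huv
    left
    rw [h.symm, h.adj _ _ hux, h.self, zero_add]
  · obtain ⟨y, hy, hyv, hy'⟩ := h.step u v huv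
    by_cases hxy : x = y
    · exact Or.inr (hxy ▸ hyv)
    · exact Or.inl (hy' x hux hxy)

theorem exists_walk (h : G.IsTreeDist D) (u v : V) :
    ∃ p : G.Walk u v, (p.length : ℤ) = D u v := by
  obtain ⟨n, hn⟩ := Int.eq_ofNat_of_zero_le (h.nonneg u v)
  induction n generalizing u with
  | zero =>
    obtain rfl := h.eq_of_eq_zero hn
    exact ⟨.nil, by simp [h.self]⟩
  | succ n ih =>
    have huv : u ≠ v := by
      rintro rfl
      have := h.self u
      omega
    obtain ⟨x, hx, hxv, -⟩ := h.step u v huv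
    obtain ⟨p, hp⟩ := ih x (by omega)
    exact ⟨.cons hx p, by rw [SimpleGraph.Walk.length_cons]; omega⟩

theorem le_length (h : G.IsTreeDist D) {u v : V} (p : G.Walk u v) : D u v ≤ p.length := by
  induction p with
  | nil => simp [h.self]
  | @cons a b c hadj p ih =>
    rw [SimpleGraph.Walk.length_cons]
    push_cast
    rcases h.adj_cases hadj c with h | h <;> omega

/-- Descending through closer neighbours yields a walk of length `D u v`; conversely `D` changes by
one along each edge, so no walk is shorter. -/
theorem eq_dist (h : G.IsTreeDist D) (u v : V) : D u v = G.dist u v := by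
  obtain ⟨p, hp⟩ := h.exists_walk u v
  obtain ⟨q, hq⟩ := p.reachable.exists_walk_length_eq_dist
  have h1 := SimpleGraph.dist_le p
  have h2 := h.le_length q
  omega

theorem triangle (h : G.IsTreeDist D) (u v w : V) : D u w ≤ D u v + D v w := by
  obtain ⟨p, hp⟩ := h.exists_walk u v
  obtain ⟨q, hq⟩ := h.exists_walk v w
  have := h.le_length (p.append q)
  rw [SimpleGraph.Walk.length_append] at this
  omega

/-- Removing the edge `ab` leaves `p` on the side of `a` and its neighbour `q` on the side of `b`
only if `p = a` and `q = b`. -/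
theorem eq_of_separated (h : G.IsTreeDist D) {a b p q : V} (hab : G.Adj a b) (hpq : G.Adj p q)
    (hp : D b p - D a p = 1) (hq : D b q - D a q = -1) : p = a ∧ q = b := by
  have h1 := h.adj_cases hpq a
  have h2 := h.adj_cases hpq b
  rw [h.symm b p, h.symm a p] at hp
  rw [h.symm b q, h.symm a q] at hq
  -- The hypotheses force `q` to be closer to `b` than `p` and farther from `a`. If `p ≠ a`, the
  -- neighbour `x` of `p` towards `a` differs from `q`, so it is farther from `b`; its distances to
  -- `a` and `b` then differ by 3, although `a` and `b` are adjacent.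
  have hpa : p = a := by
    by_contra hne
    obtain ⟨x, hx, hxa, -⟩ := h.step p a hne
    have hpb : p ≠ b := by
      rintro rfl
      have := h.self p
      have := h.nonneg p a
      omega
    obtain ⟨y, hy, hyb, hy'⟩ := h.step p b hpb
    have hqy : q = y := by
      by_contra hqy
      have := hy' q hpq hqy
      omega
    have hxq : x ≠ q := by rintro rfl; omega
    have hxb := hy' x hx (hqy ▸ hxq)
    have h3 := h.adj_cases hab x
    rw [h.symm b x, h.symm a x] at h3
    omega
  subst hpa
  refine ⟨rfl, h.eq_of_eq_zero ?_⟩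
  have := h.self p
  have := h.adj _ _ hab
  omega

open Classical in
-- This Laplacian identity underlies the hitting times, the degree sum and the sum of the offsets.
theorem sum_neighborFinset [Fintype V] (h : G.IsTreeDist D) (u v : V) :
    ∑ x ∈ G.neighborFinset u, (D x v - D u v) = G.degree u - 2 * (if u = v then 0 else 1) := by
  rw [← SimpleGraph.card_neighborFinset_eq_degree]
  by_cases huv : u = v
  · subst huv
    rw [Finset.sum_congr rfl (g := fun _ => (1 : ℤ))]
    · simp
    · intro x hx
      rw [h.self, sub_zero, h.symm, h.adj _ _ ((G.mem_neighborFinset u x).1 hx)]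
  · obtain ⟨y, hy, hyv, hy'⟩ := h.step u v huv
    have hmem : y ∈ G.neighborFinset u := (G.mem_neighborFinset u y).2 hy
    rw [← Finset.add_sum_erase _ _ hmem, Finset.sum_congr rfl (g := fun _ => (1 : ℤ))]
    · have := Finset.card_erase_add_one hmem
      rw [← this]
      simp only [hyv, Finset.sum_const, huv, if_false, nsmul_eq_mul]
      push_cast
      ring
    · intro x hx
      rw [Finset.mem_erase, SimpleGraph.mem_neighborFinset] at hx
      rw [hy' x hx.2 hx.1]
      ring

end SimpleGraph.IsTreeDist

namespace FinGraph

/-! ### Hitting times on trees -/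

variable {G : FinGraph.{u}} {D : G.V → G.V → ℤ}

theorem wiener_eq_of_isTreeDist (h : G.graph.IsTreeDist D) :
    G.wiener = 1 / 2 * ∑ u, ∑ v, (D u v : ℝ) := by
  simp [wiener, h.eq_dist]

/-- The Laplacian of any function sums to zero over all vertices; apply this to the distance to a
fixed vertex. -/
theorem sum_deg_of_isTreeDist (h : G.graph.IsTreeDist D) [Nonempty G.V] :
    ∑ u, (G.deg u : ℝ) = 2 * (G.order - 1) := by
  classical
  obtain ⟨v⟩ := ‹Nonempty G.V›
  have h0 : ∑ u, ∑ x ∈ G.graph.neighborFinset u, (D x v - D u v) = 0 := by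
    have h1 : ∑ u, ∑ x ∈ G.graph.neighborFinset u, D x v =
        ∑ u, ∑ x ∈ G.graph.neighborFinset u, D u v := by
      rw [Finset.sum_comm' (t' := Finset.univ) (s' := fun x => G.graph.neighborFinset x)]
      intro x y
      simp [SimpleGraph.adj_comm]
    simp [Finset.sum_sub_distrib, h1]
  have h2 : ∑ u, ((G.deg u : ℤ) - 2 * (if u = v then 0 else 1)) = 0 := by
    rw [← h0]
    refine Finset.sum_congr rfl fun u _ => ?_
    convert (h.sum_neighborFinset u v).symm
    rfl
  have h3 : ∑ u : G.V, (if u = v then (0 : ℤ) else 1) = G.order - 1 := by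
    have : ∀ u : G.V, (if u = v then (0 : ℤ) else 1) = 1 - if u = v then 1 else 0 := by
      intro u; split_ifs <;> simp
    simp [this, order]
  rw [Finset.sum_sub_distrib, ← Finset.mul_sum, h3] at h2
  have : ((∑ u, (G.deg u : ℤ) : ℤ) : ℝ) = ((2 * (G.order - 1) : ℤ) : ℝ) := by
    exact_mod_cast sub_eq_zero.1 h2
  push_cast at this
  exact this

/-- The hitting times of a tree with distance `D`. -/
noncomputable def treeHit (G : FinGraph.{u}) (D : G.V → G.V → ℤ) (u v : G.V) : ℝ :=
  1 / 2 * ∑ w, (G.deg w : ℝ) * (D u v + D v w - D u w)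

theorem treeHit_nonneg (h : G.graph.IsTreeDist D) (u v : G.V) : 0 ≤ G.treeHit D u v := by
  refine mul_nonneg (by norm_num) (Finset.sum_nonneg fun w _ => mul_nonneg (by positivity) ?_)
  have := h.triangle u v w
  have : (D u w : ℝ) ≤ D u v + D v w := by exact_mod_cast this
  linarith

open Classical in
-- In the Laplacian of `treeHit` the contributions of `D u v` and `D u w` cancel for every `w`
-- except `w = u`, which leaves `- G.deg u`.
theorem sum_neighborFinset_treeHit (h : G.graph.IsTreeDist D) {u v : G.V} (huv : u ≠ v) :
    ∑ x ∈ G.graph.neighborFinset u, G.treeHit D x v = G.deg u * (G.treeHit D u v - 1) := by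
  have hL : ∀ w, ∑ x ∈ G.graph.neighborFinset u, ((D x w : ℝ) - D u w) =
      G.deg u - 2 * (if u = w then 0 else 1) := by
    intro w
    have := congrArg (Int.cast (R := ℝ)) (h.sum_neighborFinset u w)
    push_cast at this
    exact this
  have hd : ∑ x ∈ G.graph.neighborFinset u, (G.treeHit D x v - G.treeHit D u v) = - G.deg u := by
    have h1 : ∀ x, G.treeHit D x v - G.treeHit D u v =
        1 / 2 * ∑ w, (G.deg w : ℝ) * (((D x v : ℝ) - D u v) - (D x w - D u w)) := by
      intro x
      rw [treeHit, treeHit, ← mul_sub, ← Finset.sum_sub_distrib]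
      congr 1
      refine Finset.sum_congr rfl fun w _ => ?_
      ring
    simp only [h1]
    rw [← Finset.mul_sum, Finset.sum_comm]
    simp only [← Finset.mul_sum, Finset.sum_sub_distrib (f := fun x => (D x v : ℝ) - D u v), hL,
      if_neg huv]
    rw [Finset.sum_congr rfl (g := fun w => if u = w then -2 * (G.deg w : ℝ) else 0)]
    · simp
    · intro w _
      split_ifs <;> ring
  rw [Finset.sum_sub_distrib, Finset.sum_const, SimpleGraph.card_neighborFinset_eq_degree] at hd
  have : G.graph.degree u = G.deg u := rfl
  rw [this, nsmul_eq_mul] at hd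
  linarith

theorem hittingTime_eq_treeHit (h : G.graph.IsTreeDist D) (u v : G.V) :
    G.hittingTime u v = ENNReal.ofReal (G.treeHit D u v) := by
  classical
  refine G.hittingTime_eq_of_solution v (fun x => ENNReal.ofReal (G.treeHit D x v))
    (fun _ => ENNReal.ofReal_ne_top) (by simp [treeHit, h.self]) (fun x hx => ?_) u
  obtain ⟨y, hy, -⟩ := h.step x v hx
  have hne : (G.graph.neighborFinset x).Nonempty := ⟨y, by simpa using hy⟩
  have hdeg : 0 < G.deg x := by
    rw [deg, ← SimpleGraph.card_neighborFinset_eq_degree]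
    exact Finset.card_pos.2 (by convert hne)
  have hdeg' : (0 : ℝ) < G.deg x := by exact_mod_cast hdeg
  have hstep : ∀ y, G.stepLaw x y = if y ∈ G.graph.neighborFinset x then
      ENNReal.ofReal ((G.deg x : ℝ)⁻¹) else 0 := by
    intro y
    rw [stepLaw, dif_pos (by convert hne), PMF.uniformOfFinset_apply,
      ENNReal.ofReal_inv_of_pos hdeg', ENNReal.ofReal_natCast]
    congr!
  have hsum : ∑ y, G.stepLaw x y * ENNReal.ofReal (G.treeHit D y v) =
      ENNReal.ofReal ((G.deg x : ℝ)⁻¹ * ∑ y ∈ G.graph.neighborFinset x, G.treeHit D y v) := by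
    simp only [hstep, ite_mul, zero_mul]
    rw [Finset.sum_ite_mem, Finset.univ_inter, Finset.mul_sum, ENNReal.ofReal_sum_of_nonneg]
    · exact Finset.sum_congr rfl fun y _ => (ENNReal.ofReal_mul (by positivity)).symm
    · exact fun y _ => mul_nonneg (by positivity) (treeHit_nonneg h y v)
  have hs : ∑ y ∈ G.graph.neighborFinset x, G.treeHit D y v =
      G.deg x * (G.treeHit D x v - 1) := by
    convert sum_neighborFinset_treeHit h hx
  -- Needed to add inside `ENNReal.ofReal`: the quantity is an average of nonnegative values over
  -- the neighbours.
  have hge : 0 ≤ G.treeHit D x v - 1 := by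
    rw [← mul_nonneg_iff_of_pos_left hdeg', ← hs]
    exact Finset.sum_nonneg fun y _ => treeHit_nonneg h y v
  rw [hsum, hs, inv_mul_cancel_left₀ hdeg'.ne', ← ENNReal.ofReal_one,
    ← ENNReal.ofReal_add zero_le_one hge]
  congr 1
  ring

theorem hittingTime_ne_top (h : G.graph.IsTreeDist D) (u v : G.V) : G.hittingTime u v ≠ ∞ := by
  rw [hittingTime_eq_treeHit h]
  exact ENNReal.ofReal_ne_top

theorem sum_treeHit (h : G.graph.IsTreeDist D) [Nonempty G.V] :
    ∑ u, ∑ v, G.treeHit D u v = 2 * (G.order - 1) * G.wiener := by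
  have h1 : ∀ w, ∑ u, ∑ v, ((D u v : ℝ) + D v w - D u w) = ∑ u, ∑ v, (D u v : ℝ) := by
    intro w
    simp only [Finset.sum_sub_distrib, Finset.sum_add_distrib, Finset.sum_const,
      ← Finset.smul_sum]
    ring
  have h2 : ∑ u, ∑ v, G.treeHit D u v =
      1 / 2 * ∑ w, (G.deg w : ℝ) * ∑ u, ∑ v, ((D u v : ℝ) + D v w - D u w) := by
    simp only [treeHit, ← Finset.mul_sum]
    congr 1
    simp only [Finset.mul_sum]
    rw [Finset.sum_comm' (t' := Finset.univ) (s' := fun _ => Finset.univ) (by simp)]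
    rw [Finset.sum_congr rfl fun u _ => Finset.sum_comm]
    rw [Finset.sum_comm]
    exact Finset.sum_congr rfl fun w _ => Finset.sum_comm
  rw [h2]
  simp only [h1]
  rw [← Finset.sum_mul, sum_deg_of_isTreeDist h, wiener_eq_of_isTreeDist h]
  ring

theorem meanHittingTime_of_isTreeDist (h : G.graph.IsTreeDist D) [Nonempty G.V] :
    G.meanHittingTime = 2 / G.order * G.wiener := by
  have h1 : ∑ u : G.V, ∑ v : G.V, (G.hittingTime u v).toReal =
      2 * (G.order - 1) * G.wiener := by
    rw [← sum_treeHit h]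
    simp only [hittingTime_eq_treeHit h, ENNReal.toReal_ofReal (treeHit_nonneg h _ _)]
  rw [meanHittingTime, h1]
  -- For a single vertex the mean is a division by zero, read as 0, and the Wiener index is 0 too.
  by_cases hc : G.order = 1
  · have hW : G.wiener = 0 := by
      obtain ⟨x, hx⟩ := Fintype.card_eq_one_iff.1 hc
      simp [wiener, hx]
    simp [hW]
  · have hc' : (G.order : ℝ) - 1 ≠ 0 := sub_ne_zero.2 (by exact_mod_cast hc)
    have h0 : (G.order : ℝ) ≠ 0 := by exact_mod_cast (Fintype.card_pos (α := G.V)).ne'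
    field_simp

end FinGraph

namespace FinGraph

variable {G : FinGraph.{u}} {m : ℕ} {D : G.V → G.V → ℤ}

/-! ### Distances after the V-fractal operation -/

/-- The old vertex whose cluster contains a vertex of the new graph. -/
def vRoot : VVertex G m → G.V
  | .old u => u
  | .mid d => d.fst
  | .leaf u _ => u

/-- The distance from a vertex of the new graph to a far cluster, relative to that from its root. -/
def vOffset (D : G.V → G.V → ℤ) : VVertex G m → G.V → ℤ
  | .old _, _ => 0
  | .mid d, w => D d.snd w - D d.fst w
  | .leaf _ _, _ => 1

open Classical in
/-- The distance after the V-fractal operation, in terms of the distance `D` before. -/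
noncomputable def vDist (D : G.V → G.V → ℤ) (x y : VVertex G m) : ℤ :=
  if x = y then 0 else
    3 * D (vRoot x) (vRoot y) + vOffset D x (vRoot y) + vOffset D y (vRoot x)

theorem vDist_of_ne {x y : VVertex G m} (h : x ≠ y) : vDist D x y =
    3 * D (vRoot x) (vRoot y) + vOffset D x (vRoot y) + vOffset D y (vRoot x) := if_neg h

@[simp]
theorem vDist_self (x : VVertex G m) : vDist D x x = 0 := if_pos rfl

/-- No inequality of the vertices is required: at an old vertex both offsets vanish, so the formula
is right on the diagonal as well. -/
theorem vDist_old (h : G.graph.IsTreeDist D) (u : G.V) (y : VVertex G m) :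
    vDist D (.old u) y = 3 * D u (vRoot y) + vOffset D y u := by
  by_cases hy : .old u = y
  · subst hy
    simp [vRoot, vOffset, h.self]
  · simp [vDist_of_ne hy, vRoot, vOffset]

theorem vOffset_mid (h : G.graph.IsTreeDist D) (d : G.graph.Dart) (w : G.V) :
    vOffset (m := m) D (.mid d) w = 1 ∨ vOffset (m := m) D (.mid d) w = -1 := by
  rcases h.adj_cases d.adj w with h | h <;> simp [vOffset, h]

theorem vOffset_mid_fst (h : G.graph.IsTreeDist D) (d : G.graph.Dart) :
    vOffset (m := m) D (.mid d) d.fst = 1 := by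
  simp [vOffset, h.self, h.adj _ _ d.adj.symm]

theorem neg_one_le_vOffset (h : G.graph.IsTreeDist D) (x : VVertex G m) (w : G.V) :
    -1 ≤ vOffset D x w := by
  rcases x with u | d | ⟨u, i⟩
  · simp [vOffset]
  · rcases vOffset_mid (m := m) h d w with h | h <;> omega
  · simp [vOffset]

theorem vOffset_vRoot_nonneg (h : G.graph.IsTreeDist D) (x : VVertex G m) :
    0 ≤ vOffset D x (vRoot x) := by
  rcases x with u | d | ⟨u, i⟩
  · simp [vOffset]
  · simp [vRoot, vOffset_mid_fst h]
  · simp [vOffset]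

theorem vOffset_vRoot_of_ne_old (h : G.graph.IsTreeDist D) {x : VVertex G m}
    (hx : x ≠ .old (vRoot x)) : vOffset D x (vRoot x) = 1 := by
  rcases x with u | d | ⟨u, i⟩
  · exact absurd rfl hx
  · simp [vRoot, vOffset_mid_fst h]
  · simp [vOffset]

/-- Both ends of an edge lie on the same side of any other edge, by `eq_of_separated`. -/
theorem vOffset_snd_eq (h : G.graph.IsTreeDist D) {d : G.graph.Dart} {y : VVertex G m}
    (hd : y ≠ .mid d) (hd' : y ≠ .mid d.symm) : vOffset D y d.snd = vOffset D y d.fst := by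
  rcases y with u | e | ⟨u, i⟩
  · rfl
  · have h1 := vOffset_mid (m := m) h e d.fst
    have h2 := vOffset_mid (m := m) h e d.snd
    simp only [vOffset] at h1 h2 ⊢
    rcases h1 with h1 | h1 <;> rcases h2 with h2 | h2 <;> try omega
    · obtain ⟨h3, h4⟩ := h.eq_of_separated e.adj d.adj h1 h2
      exact absurd (congrArg _ (SimpleGraph.Dart.ext _ _ (Prod.ext h3.symm h4.symm))) hd
    · obtain ⟨h3, h4⟩ := h.eq_of_separated e.adj d.adj.symm h2 h1
      exact absurd (congrArg _ (SimpleGraph.Dart.ext _ _ (Prod.ext h3.symm h4.symm))) hd'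
  · rfl

theorem vDist_isTreeDist (h : G.graph.IsTreeDist D) :
    (G.vGraph m).IsTreeDist (vDist D) where
  nonneg x y := by
    by_cases hxy : x = y
    · simp [hxy]
    · rw [vDist_of_ne hxy]
      -- Within one cluster the offsets are nonnegative; between clusters `3 * D` is at least 3 and
      -- outweighs two offsets of −1.
      by_cases hr : vRoot x = vRoot y
      · have h1 := vOffset_vRoot_nonneg h x
        have h2 := vOffset_vRoot_nonneg h y
        have h3 := h.nonneg (vRoot x) (vRoot y)
        rw [← hr] at h2 h3 ⊢
        omega
      · have h1 := neg_one_le_vOffset h x (vRoot y)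
        have h2 := neg_one_le_vOffset h y (vRoot x)
        have h3 := h.nonneg (vRoot x) (vRoot y)
        have h4 : D (vRoot x) (vRoot y) ≠ 0 := fun h0 => hr (h.eq_of_eq_zero h0)
        omega
  self x := vDist_self x
  symm x y := by
    by_cases hxy : x = y
    · rw [hxy]
    · rw [vDist_of_ne hxy, vDist_of_ne (Ne.symm hxy), h.symm]
      ring
  adj x y hxy := by
    rcases x with u | d | ⟨u, i⟩ <;> rcases y with v | e | ⟨v, j⟩ <;>
      simp only [vGraph, VAdj] at hxy
    · subst hxy
      simp [vDist_of_ne, vRoot, h.self, vOffset, h.adj _ _ e.adj.symm]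
    · subst hxy
      simp [vDist_of_ne, vRoot, h.self, vOffset]
    · subst hxy
      simp [vDist_of_ne, vRoot, h.self, vOffset, h.adj _ _ d.adj.symm]
    · subst hxy
      have : VVertex.mid (m := m) d ≠ .mid d.symm := fun h => d.symm_ne (VVertex.mid.inj h).symm
      simp [vDist_of_ne this, vRoot, h.self, vOffset, h.adj _ _ d.adj, h.adj _ _ d.adj.symm]
    · subst hxy
      simp [vDist_of_ne, vRoot, h.self, vOffset]
  step x y hxy := by
    rcases x with u | d | ⟨u, i⟩
    · rw [vDist_old h]
      -- In its own cluster `y` is itself a neighbour of `u`, and all other neighbours are at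
      -- distance 2 from it. Otherwise the closer neighbour is the one placed on the edge towards
      -- `vRoot y`.
      by_cases hr : u = vRoot y
      · subst hr
        have hy := vOffset_vRoot_of_ne_old h (x := y) (Ne.symm hxy)
        refine ⟨y, ?_, ?_, ?_⟩
        · rcases y with v | e | ⟨v, j⟩
          · exact absurd rfl hxy
          · rfl
          · rfl
        · simp [h.self, hy]
        · intro z hz hzy
          have hzr : vRoot z = vRoot y ∧ z ≠ .old (vRoot z) := by
            rcases z with v | e | ⟨v, j⟩ <;> simp only [vGraph, VAdj] at hz
            · exact ⟨hz, by simp⟩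
            · exact ⟨hz.symm, by simp⟩
          have hz1 := vOffset_vRoot_of_ne_old h hzr.2
          rw [hzr.1] at hz1
          rw [vDist_of_ne hzy, hzr.1, hz1, hy, h.self]
      · obtain ⟨w, hw, hwD, hw'⟩ := h.step u (vRoot y) hr
        have key : ∀ d : G.graph.Dart, d.fst = u → vDist D (.mid d) y =
            3 * D u (vRoot y) + (D d.snd (vRoot y) - D u (vRoot y)) + vOffset D y u := by
          rintro d rfl
          have : VVertex.mid d ≠ y := by
            rintro rfl
            exact hr rfl
          simp [vDist_of_ne this, vRoot, vOffset]
        refine ⟨.mid ⟨(u, w), hw⟩, rfl, ?_, ?_⟩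
        · rw [key _ rfl]
          simp only
          omega
        · intro z hz hzw
          rcases z with v | e | ⟨v, j⟩ <;> simp only [vGraph, VAdj] at hz
          · rw [key _ hz, hw' e.snd (hz ▸ e.adj)]
            · ring
            · rintro rfl
              apply hzw
              congr 1
              exact SimpleGraph.Dart.ext _ _ (Prod.ext hz rfl)
          · subst hz
            have : VVertex.leaf u j ≠ y := by
              rintro rfl
              exact hr rfl
            rw [vDist_of_ne this]
            simp only [vRoot, vOffset]
            ring
    · have hN : ∀ z, (G.vGraph m).Adj (.mid d) z ↔ z = .old d.fst ∨ z = .mid d.symm := by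
        rintro (v | e | ⟨v, j⟩)
        · simp [vGraph, VAdj, eq_comm]
        · simp [vGraph, VAdj]
        · simp [vGraph, VAdj]
      -- The partner on the same edge is treated apart: it is the only `y ≠ .mid d` whose offset
      -- differs between the two ends of `d`.
      by_cases hy : y = .mid d.symm
      · subst hy
        have hv : vDist (m := m) D (.mid d) (.mid d.symm) = 1 := by
          rw [vDist_of_ne hxy]
          simp [vRoot, h.self, vOffset, h.adj _ _ d.adj, h.adj _ _ d.adj.symm]
        refine ⟨.mid d.symm, (hN _).2 (Or.inr rfl), by simp [hv], fun z hz hne => ?_⟩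
        rcases (hN z).1 hz with rfl | rfl
        · rw [vDist_old h, hv]
          simp [vRoot, vOffset, h.self, h.adj _ _ d.adj, h.adj _ _ d.adj.symm]
        · exact absurd rfl hne
      · have ho := vOffset_snd_eq h (Ne.symm hxy) hy
        have h1 : vDist D (.mid d) y = 3 * D d.fst (vRoot y) +
            (D d.snd (vRoot y) - D d.fst (vRoot y)) + vOffset D y d.fst := by
          rw [vDist_of_ne hxy]
          rfl
        have h2 : vDist D (.mid d.symm) y = 3 * D d.snd (vRoot y) +
            (D d.fst (vRoot y) - D d.snd (vRoot y)) + vOffset D y d.fst := by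
          rw [vDist_of_ne (Ne.symm hy), ← ho]
          rfl
        have h3 := vDist_old h d.fst y
        -- The closer neighbour of `.mid d` lies on the side of whichever end of `d` is nearer to
        -- `vRoot y`.
        rcases h.adj_cases d.adj (vRoot y) with hc | hc
        · refine ⟨.old d.fst, (hN _).2 (Or.inl rfl), by omega, fun z hz hne => ?_⟩
          rcases (hN z).1 hz with rfl | rfl
          · exact absurd rfl hne
          · omega
        · refine ⟨.mid d.symm, (hN _).2 (Or.inr rfl), by omega, fun z hz hne => ?_⟩
          rcases (hN z).1 hz with rfl | rfl
          · omega
          · exact absurd rfl hne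
    · refine ⟨.old u, rfl, ?_, ?_⟩
      · rw [vDist_old h, vDist_of_ne hxy]
        simp only [vRoot, vOffset]
        ring
      · intro z hz hne
        rcases z with v | e | ⟨v, j⟩ <;> simp only [vGraph, VAdj] at hz
        exact absurd (congrArg _ hz) hne

/-! ### Sums over the vertices of the new graph -/

open Classical in
theorem sum_dart {M : Type*} [AddCommMonoid M] (G : FinGraph.{u}) (f : G.V → G.V → M) :
    ∑ d : G.graph.Dart, f d.fst d.snd = ∑ u, ∑ v ∈ G.graph.neighborFinset u, f u v := by
  rw [Finset.sum_sigma']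
  refine Finset.sum_bij' (fun d _ => ⟨d.fst, d.snd⟩)
    (fun p hp => ⟨(p.1, p.2), by simpa using hp⟩) ?_ ?_ ?_ ?_ ?_ <;> simp [SimpleGraph.Dart.adj]

open Classical in
theorem sum_vVertex {M : Type*} [AddCommMonoid M] (f : VVertex G m → M) :
    ∑ x, f x = ∑ u, f (.old u) + (∑ d, f (.mid d) + ∑ u, ∑ i, f (.leaf u i)) := by
  rw [← (G.vVertexEquiv m).symm.sum_comp f, Fintype.sum_sum_type, Fintype.sum_sum_type,
    Fintype.sum_sigma]
  rfl

/-- The cluster of `u` has 1 + deg u + (m − deg u) = m + 1 vertices; applicability makes the natural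
subtraction exact. -/
theorem sum_vRoot (hm : VApplicable m G) (f : G.V → ℤ) :
    ∑ x : VVertex G m, f (vRoot x) = (m + 1) * ∑ u, f u := by
  classical
  rw [sum_vVertex, Finset.mul_sum]
  simp only [vRoot]
  rw [sum_dart G fun u _ => f u, ← Finset.sum_add_distrib, ← Finset.sum_add_distrib]
  refine Finset.sum_congr rfl fun u _ => ?_
  have h1 : (G.graph.neighborFinset u).card = G.deg u := by
    rw [SimpleGraph.card_neighborFinset_eq_degree, deg]
  simp only [Finset.sum_const, Finset.card_univ, Fintype.card_fin, h1, nsmul_eq_mul,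
    Nat.cast_sub (hm u)]
  ring

/-- In the cluster of `u` the edge vertices contribute the Laplacian of the distance to `w` and the
leaves contribute m − deg u. The degree cancels, leaving m − 2, or m if `u = w`. -/
theorem sum_vOffset (h : G.graph.IsTreeDist D) (hm : VApplicable m G) (w : G.V) :
    ∑ x : VVertex G m, vOffset D x w = (m - 2) * G.order + 2 := by
  classical
  rw [sum_vVertex]
  simp only [vOffset]
  rw [sum_dart G fun u v => D v w - D u w, Finset.sum_const_zero, zero_add,
    ← Finset.sum_add_distrib]
  have h1 : ∀ u, ∑ v ∈ G.graph.neighborFinset u, (D v w - D u w) +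
      ∑ _i : Fin (m - G.deg u), (1 : ℤ) = (m - 2) + if u = w then 2 else 0 := by
    intro u
    have h2 : (G.graph.degree u : ℤ) = G.deg u := by rw [deg]
    rw [h.sum_neighborFinset u w, h2]
    simp only [Finset.sum_const, Finset.card_univ, Fintype.card_fin, nsmul_eq_mul,
      Nat.cast_sub (hm u)]
    split_ifs <;> ring
  rw [Finset.sum_congr rfl fun u _ => h1 u]
  simp only [Finset.sum_add_distrib, Finset.sum_const, Finset.card_univ, nsmul_eq_mul,
    Finset.sum_ite_eq', Finset.mem_univ, if_true, order]
  ring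

/-- Every vertex of a cluster but the old one contributes 1. -/
theorem sum_vOffset_vRoot (h : G.graph.IsTreeDist D) (hm : VApplicable m G) :
    ∑ x : VVertex G m, vOffset D x (vRoot x) = m * G.order := by
  classical
  have h1 := sum_vRoot hm (fun _ => 1)
  rw [sum_vVertex] at h1 ⊢
  simp only [vRoot, vOffset_mid_fst h]
  simp only [vOffset]
  simp only [Finset.sum_const, Finset.card_univ, nsmul_eq_mul, mul_one, mul_zero, order] at h1 ⊢
  linarith

theorem order_vOp (hm : VApplicable m G) : (vOp m G).order = G.order * (m + 1) := by
  have h1 := sum_vRoot hm (fun _ => 1)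
  simp only [Finset.sum_const, Finset.card_univ, nsmul_eq_mul, mul_one] at h1
  have h2 : Fintype.card (VVertex G m) = (m + 1) * G.order := by exact_mod_cast h1
  rw [mul_comm, ← h2]
  rfl

theorem sum_vDist (h : G.graph.IsTreeDist D) (hm : VApplicable m G) :
    ∑ x : VVertex G m, ∑ y : VVertex G m, vDist D x y =
      3 * (m + 1) ^ 2 * ∑ u, ∑ v, D u v
        + 2 * ((m - 2) * (m + 1) * G.order ^ 2 + (m + 2) * G.order) := by
  classical
  -- The distance formula is extended to all pairs; at `x = y` it overshoots by twice the offset at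
  -- the own root. This correction, `2 * m * G.order` in total, turns 4(m + 1) into 2(m + 2) in the
  -- linear term.
  have h1 : ∀ x y : VVertex G m, vDist D x y =
      3 * D (vRoot x) (vRoot y) + vOffset D x (vRoot y) + vOffset D y (vRoot x) -
        if x = y then 2 * vOffset D x (vRoot x) else 0 := by
    intro x y
    by_cases hxy : x = y
    · subst hxy
      simp only [vDist_self, h.self, if_true]
      ring
    · rw [vDist_of_ne hxy, if_neg hxy, sub_zero]
  have h2 : ∑ x : VVertex G m, ∑ y : VVertex G m, vOffset D x (vRoot y) =
      (m + 1) * (((m : ℤ) - 2) * G.order + 2) * G.order := by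
    rw [Finset.sum_congr rfl fun x _ => sum_vRoot hm (vOffset D x)]
    rw [← Finset.mul_sum, Finset.sum_comm]
    simp only [sum_vOffset h hm, Finset.sum_const, Finset.card_univ, nsmul_eq_mul, order]
    ring
  have h3 : ∑ x : VVertex G m, ∑ y : VVertex G m, vOffset D y (vRoot x) =
      (m + 1) * (((m : ℤ) - 2) * G.order + 2) * G.order := by
    rw [Finset.sum_comm, h2]
  have h4 : ∑ x : VVertex G m, ∑ y : VVertex G m, D (vRoot x) (vRoot y) =
      (m + 1) ^ 2 * ∑ u, ∑ v, D u v := by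
    rw [Finset.sum_congr rfl fun x _ => sum_vRoot hm (D (vRoot x))]
    rw [← Finset.mul_sum, sum_vRoot hm fun u => ∑ v, D u v]
    ring
  simp only [h1, Finset.sum_sub_distrib, Finset.sum_add_distrib, h2, h3, ← Finset.mul_sum, h4,
    Finset.sum_ite_eq, Finset.mem_univ, if_true, sum_vOffset_vRoot h hm]
  ring

theorem wiener_vOp (h : G.graph.IsTreeDist D) (hm : VApplicable m G) :
    (vOp m G).wiener = 3 * ((m : ℝ) + 1) ^ 2 * G.wiener
      + ((m : ℝ) - 2) * (m + 1) * (G.order : ℝ) ^ 2 + ((m : ℝ) + 2) * G.order := by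
  have h1 := congrArg (Int.cast (R := ℝ)) (sum_vDist h hm)
  have h2 : (vOp m G).wiener = 1 / 2 * ∑ x : VVertex G m, ∑ y : VVertex G m, (vDist D x y : ℝ) :=
    wiener_eq_of_isTreeDist (G := vOp m G) (vDist_isTreeDist h)
  push_cast at h1
  rw [h2, h1, wiener_eq_of_isTreeDist h]
  ring

/-! ### Iteration -/

theorem exists_isTreeDist_vFractal (T : FinGraph.{u}) (hT : T.graph.IsTree) (m t : ℕ) :
    ∃ D, (vFractal m T t).graph.IsTreeDist D := by
  induction t with
  | zero => exact ⟨_, hT.isTreeDist⟩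
  | succ t ih =>
    obtain ⟨D, hD⟩ := ih
    exact ⟨_, vDist_isTreeDist hD⟩

theorem order_vFractal (T : FinGraph.{u}) (m t : ℕ)
    (hm : ∀ s < t, VApplicable m (vFractal m T s)) :
    (vFractal m T t).order = T.order * (m + 1) ^ t := by
  induction t with
  | zero => simp [vFractal]
  | succ t ih =>
    rw [vFractal, order_vOp (hm t t.lt_succ_self), ih fun s hs => hm s (hs.trans t.lt_succ_self)]
    ring

/-- One step of the recursion W' = f W + a, in the form of the unrolled sum: the newest term has `i
= 0`, and all older ones gain a factor `f`. -/
theorem sum_range_succ_reflected (f : ℝ) (a : ℕ → ℝ) (t : ℕ) :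
    ∑ i ∈ Finset.range (t + 1), f ^ i * a (t + 1 - 1 - i) =
      a t + f * ∑ i ∈ Finset.range t, f ^ i * a (t - 1 - i) := by
  rw [Finset.sum_range_succ', Finset.mul_sum, add_comm]
  congr 1
  · simp
  · refine Finset.sum_congr rfl fun i _ => ?_
    rw [show t + 1 - 1 - (i + 1) = t - 1 - i by omega]
    ring

theorem wiener_vFractal (T : FinGraph.{u}) (hT : T.graph.IsTree) (m t : ℕ)
    (hm : ∀ s < t, VApplicable m (vFractal m T s)) :
    (vFractal m T t).wiener = (3 * ((m : ℝ) + 1) ^ 2) ^ t * T.wiener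
      + ((m : ℝ) - 2) * ((m : ℝ) + 1) *
        ∑ i ∈ Finset.range t, (3 * ((m : ℝ) + 1) ^ 2) ^ i *
          ((vFractal m T (t - 1 - i)).order : ℝ) ^ 2
      + ((m : ℝ) + 2) *
        ∑ i ∈ Finset.range t, (3 * ((m : ℝ) + 1) ^ 2) ^ i *
          ((vFractal m T (t - 1 - i)).order : ℝ) := by
  induction t with
  | zero => simp [vFractal]
  | succ t ih =>
    obtain ⟨D, hD⟩ := exists_isTreeDist_vFractal T hT m t
    rw [vFractal, wiener_vOp hD (hm t t.lt_succ_self),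
      ih fun s hs => hm s (hs.trans t.lt_succ_self),
      sum_range_succ_reflected _ (fun s => ((vFractal m T s).order : ℝ) ^ 2),
      sum_range_succ_reflected _ (fun s => ((vFractal m T s).order : ℝ))]
    ring

theorem nonempty_vFractal (T : FinGraph.{u}) [h : Nonempty T.V] (m t : ℕ) :
    Nonempty (vFractal m T t).V := by
  induction t with
  | zero => exact h
  | succ t ih =>
    obtain ⟨x⟩ := ih
    exact ⟨.old x⟩

end FinGraph

theorem propositionI14 (T : FinGraph.{u}) (hT : T.graph.IsTree) (m t : ℕ)
    (hm : ∀ s < t, FinGraph.VApplicable m (FinGraph.vFractal m T s)) :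
    (FinGraph.vFractal m T t).order = T.order * (m + 1) ^ t ∧
    (∀ u v, (FinGraph.vFractal m T t).hittingTime u v ≠ ⊤) ∧
    (FinGraph.vFractal m T t).meanHittingTime =
      2 / ((FinGraph.vFractal m T t).order : ℝ) *
        ((3 * ((m : ℝ) + 1) ^ 2) ^ t * T.wiener
          + ((m : ℝ) - 2) * ((m : ℝ) + 1) *
            ∑ i ∈ Finset.range t, (3 * ((m : ℝ) + 1) ^ 2) ^ i *
              ((FinGraph.vFractal m T (t - 1 - i)).order : ℝ) ^ 2
          + ((m : ℝ) + 2) *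
            ∑ i ∈ Finset.range t, (3 * ((m : ℝ) + 1) ^ 2) ^ i *
              ((FinGraph.vFractal m T (t - 1 - i)).order : ℝ)) := by
  obtain ⟨D, hD⟩ := FinGraph.exists_isTreeDist_vFractal T hT m t
  have := hT.connected.nonempty
  have := FinGraph.nonempty_vFractal T m t
  refine ⟨FinGraph.order_vFractal T m t hm, FinGraph.hittingTime_ne_top hD, ?_⟩
  rw [FinGraph.meanHittingTime_of_isTreeDist hD, FinGraph.wiener_vFractal T hT m t hm]
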